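/- Let $l,m\ge 0$ be integers and let $B_{lm}$ be the lattice of subsets of $\{1,\dots,m\}\times\{1,\dots,l\}$, which we identify with $\{1,\dots,lm\}$ through $(i,j)\mapsto (i-1)l+j$. We call $i$ the letter of the element $(i,j)$. The wreath product $S_l\wr S_m\subseteq S_{lm}$ is the group of all permutations that map elements with the same letter to elements with the same letter and elements with different letters to elements with different letters. Let $\Delta(B_{lm})$ be the complex of all chains of subsets strictly between $\emptyset$ and the whole set (including the empty chain), and let $\Delta(B_{lm})/S_l\wr S_m$ be the quotient boolean cell complex: its faces are the $S_l\wr S_m$-orbits of chains, and the orbit of $c$ is contained in the orbit of $d$ if $gc\subseteq d$ for some $g\in S_l\wr S_m$. The link $\mathrm{lk}(\sigma)$ of a face $\sigma$ is the boolean cell complex whose nonempty cells are the faces that properly contain $\sigma$, ordered by inclusion. Let $\sigma$ be the orbit of a chain $c$ that omits a single interval $T<S$; that is, $T\subsetneq S$ both belong to $c\cup\{\emptyset,\{1,\dots,m\}\times\{1,\dots,l\}\}$, and this extended chain has an element of cardinality $k$, for $0\le k\le lm$, if and only if $k\le |T|$ or $k\ge |S|$. Suppose that some letter occurs more than once in $S'=S\setminus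 T$, that is, $S'$ contains two distinct elements $(i,j),(i,j')$ with the same first coordinate. Then $\mathrm{lk}(\sigma)$ is collapsible: it can be reduced to a single point by a finite sequence of elementary collapses, each of which removes a cell $\rho$ together with a codimension one face $\tau\neq\emptyset$ of $\rho$ that is properly contained in no cell other than $\rho$. -/

import Mathlib

/-- The ground set of `B_{lm}`: `m` rows of `l` boxes each. The pair `(i, j)` stands for the
number `i * l + j + 1` of `{1, …, lm}`. The letter of a box is its row `i`. -/
abbrev Box (l m : ℕ) : Type := Fin m × Fin l

/-- The wreath product `S_l ≀ S_m` inside the symmetric group of the boxes: the permutations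
that permute boxes within rows and permute the rows as a whole, i.e. those that preserve the
relation of lying in the same row. -/
def wreath (l m : ℕ) : Subgroup (Equiv.Perm (Box l m)) where
  carrier := {g | ∀ x y, (g x).1 = (g y).1 ↔ x.1 = y.1}
  mul_mem' := by
    intro a b ha hb x y
    exact (ha (b x) (b y)).trans (hb x y)
  one_mem' := by
    intro x y
    exact Iff.rfl
  inv_mem' := by
    intro a ha x y
    have h := ha (a⁻¹ x) (a⁻¹ y)
    simpa using h.symm

/-- A face of the order complex `Δ(B_{lm})`: a chain of subsets strictly between `∅` and the
whole set. The empty face is included. -/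
structure ChainFace (l m : ℕ) where
  sets : Finset (Finset (Box l m))
  proper : ∀ u ∈ sets, u ≠ ∅ ∧ u ≠ Finset.univ
  chain : ∀ u ∈ sets, ∀ v ∈ sets, u ⊆ v ∨ v ⊆ u

/-- The image of a family of subsets under a permutation of the boxes. -/
def permSets {l m : ℕ} (g : Equiv.Perm (Box l m)) (c : Finset (Finset (Box l m))) :
    Finset (Finset (Box l m)) :=
  c.image (fun u => u.image g)

theorem permSets_one {l m : ℕ} (c : Finset (Finset (Box l m))) : permSets 1 c = c := by
  simp [permSets]

theorem permSets_mul {l m : ℕ} (g h : Equiv.Perm (Box l m)) (c : Finset (Finset (Box l m))) :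
    permSets (g * h) c = permSets g (permSets h c) := by
  simp only [permSets, Finset.image_image]
  congr 1
  funext u
  simp [Finset.image_image]

theorem permSets_mono {l m : ℕ} (g : Equiv.Perm (Box l m)) {c d : Finset (Finset (Box l m))}
    (h : c ⊆ d) : permSets g c ⊆ permSets g d :=
  Finset.image_subset_image h

theorem card_permSets {l m : ℕ} (g : Equiv.Perm (Box l m)) (c : Finset (Finset (Box l m))) :
    (permSets g c).card = c.card :=
  Finset.card_image_of_injective _ (Finset.image_injective g.injective)

theorem permSets_inv {l m : ℕ} {g : Equiv.Perm (Box l m)} {c d : Finset (Finset (Box l m))}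
    (h : permSets g c = d) : permSets g⁻¹ d = c := by
  rw [← h, ← permSets_mul, inv_mul_cancel, permSets_one]

/-- Two faces of `Δ(B_{lm})` are equivalent if they lie in one `S_l ≀ S_m`-orbit. -/
instance chainFaceSetoid (l m : ℕ) : Setoid (ChainFace l m) where
  r c d := ∃ g ∈ wreath l m, permSets g c.sets = d.sets
  iseqv :=
    { refl := fun c => ⟨1, one_mem _, permSets_one _⟩
      symm := fun ⟨g, hg, h⟩ => ⟨g⁻¹, inv_mem hg, permSets_inv h⟩
      trans := fun ⟨g, hg, h⟩ ⟨g', hg', h'⟩ =>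
        ⟨g' * g, mul_mem hg' hg, by rw [permSets_mul, h, h']⟩ }

/-- The faces of the quotient complex `Δ(B_{lm}) / S_l ≀ S_m`: the orbits of faces of
`Δ(B_{lm})`, including the empty face. -/
def QuotientFace (l m : ℕ) : Type := Quotient (chainFaceSetoid l m)

/-- The face of the quotient complex represented by a chain. -/
def ChainFace.orbit {l m : ℕ} (c : ChainFace l m) : QuotientFace l m :=
  Quotient.mk (chainFaceSetoid l m) c

/-- The face order of the quotient complex: the orbit of `c` is a face of the orbit of `d` if
some `g c` with `g ∈ S_l ≀ S_m` is contained in `d`. -/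
instance quotientFaceOrder (l m : ℕ) : PartialOrder (QuotientFace l m) where
  le := Quotient.lift₂ (fun c d => ∃ g ∈ wreath l m, permSets g c.sets ⊆ d.sets) (by
    rintro c d c' d' ⟨a, ha, hac⟩ ⟨b, hb, hbd⟩
    apply propext
    constructor
    · rintro ⟨g, hg, h⟩
      refine ⟨b * g * a⁻¹, mul_mem (mul_mem hb hg) (inv_mem ha), ?_⟩
      rw [permSets_mul, permSets_mul, permSets_inv hac, ← hbd]
      exact permSets_mono b h
    · rintro ⟨g, hg, h⟩
      refine ⟨b⁻¹ * g * a, mul_mem (mul_mem (inv_mem hb) hg) ha, ?_⟩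
      rw [permSets_mul, permSets_mul, hac, ← permSets_inv hbd]
      exact permSets_mono b⁻¹ h)
  le_refl := by
    intro x
    induction x using Quotient.inductionOn with
    | h c => exact ⟨1, one_mem _, by rw [permSets_one]⟩
  le_trans := by
    intro x y z
    induction x using Quotient.inductionOn
    induction y using Quotient.inductionOn
    induction z using Quotient.inductionOn
    rintro ⟨g, hg, h⟩ ⟨g', hg', h'⟩
    exact ⟨g' * g, mul_mem hg' hg, by
      rw [permSets_mul]; exact (permSets_mono g' h).trans h'⟩
  le_antisymm := by
    intro x y
    induction x using Quotient.inductionOn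
    induction y using Quotient.inductionOn
    rintro ⟨g, hg, h⟩ ⟨g', hg', h'⟩
    refine Quotient.sound ⟨g, hg, Finset.eq_of_subset_of_card_le h ?_⟩
    have h1 := Finset.card_le_card h'
    rw [card_permSets] at h1 ⊢
    exact h1

/-- The link of the face `σ` in the boolean cell complex `Δ(B_{lm}) / S_l ≀ S_m`, given by its
poset of nonempty cells: these are the faces that properly contain `σ` (a face `τ ≥ σ` with
`k` more vertices than `σ` is a `(k - 1)`-dimensional cell of the link, and `σ` itself is the
empty face of the link). -/
def link {l m : ℕ} (σ : QuotientFace l m) : Set (QuotientFace l m) := Set.Ioi σ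

/-- `K` collapses to `L` in one elementary step, where `K` is the set of nonempty cells of a
boolean cell complex, ordered by inclusion: `L` arises from `K` by removing a cell `ρ` together
with a free codimension one face `τ` of `ρ`, i.e. one that lies properly in no other cell. -/
def ElementaryCollapse {P : Type*} [PartialOrder P] (K L : Set P) : Prop :=
  ∃ τ ∈ K, ∃ ρ ∈ K, τ ⋖ ρ ∧ (∀ x ∈ K, τ < x → x = ρ) ∧ L = K \ {τ, ρ}

/-- The finite boolean cell complex with set of nonempty cells `K` is collapsible: a finite
sequence of elementary collapses reduces it to a single point. -/
def Collapsible {P : Type*} [PartialOrder P] (K : Set P) : Prop :=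
  ∃ v : P, Relation.ReflTransGen ElementaryCollapse K {v}

/-- The chain `∅ < ⋯ < [lm]` obtained from a face by adding the bottom and the top of
`B_{lm}`. -/
def ChainFace.extended {l m : ℕ} (c : ChainFace l m) : Finset (Finset (Box l m)) :=
  insert ∅ (insert Finset.univ c.sets)

/-- The chain `c` omits the single interval `T < S`: with `∅` and the whole set added, it
contains `T` and `S`, and the ranks at which it has an element are exactly those that are not
strictly between the ranks of `T` and `S`. -/
def ChainFace.OmitsSingleInterval {l m : ℕ} (c : ChainFace l m) (T S : Finset (Box l m)) : Prop :=
  T ∈ c.extended ∧ S ∈ c.extended ∧ T ⊂ S ∧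
    ∀ k ≤ l * m, (∃ u ∈ c.extended, u.card = k) ↔ (k ≤ T.card ∨ S.card ≤ k)

/-- The multiplicity of the letter `i` in a set of boxes: the number of its boxes in row `i`. -/
def letterMultiplicity {l m : ℕ} (i : Fin m) (U : Finset (Box l m)) : ℕ :=
  (U.filter (fun x => x.1 = i)).card

/-! The cells of the link, together with `σ` itself, are matched in pairs by inserting or deleting
one set. Call a letter heavy if it occurs at least twice in `S \ T`. In a chain `d ⊇ c` let the
pivot `x` be the largest element for which some heavy letter is missing, that is, does not occur
outside `T`. All heavy letters are missing from `T` and none from `S`, so `x` exists and lies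
between them. Every chain element above `x` contains a box outside `T` of each missing letter. Hence
one box per missing letter can be added to `x` without leaving the next chain element. The resulting
set has the target size, leaves the pivot unchanged, and is strictly smaller than `S` because each
missing letter is heavy (`card_add_card_missing_lt`).

The choice of boxes is immaterial in the quotient: swapping boxes within rows carries one choice to
another and fixes the rest of the chain (`exists_wreath_addBoxes`, `IsUp.orbit_eq`). A permutation
between two chains containing `c` fixes `T` and `S`, so pivot size and target size depend on the
orbit only. Thus chains without an element of target size are matched with those that have one
(`IsLower.exists_isUp`, `exists_isUp_of_not_isLower`).

The pair (size of pivot, number of sets), ordered lexicographically, shows that the matching is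
acyclic. The face `σ` is the lower member of its pair; since it is the empty face of the link, its
partner is the point that remains. -/

/-! ### Collapsing along an acyclic matching -/

/-- A matching `τ ↦ up τ` that is acyclic with respect to the potential `φ`, and in which only the
least element `σ` has no room to be removed, collapses the rest to the point `up σ`. -/
theorem collapsible_of_matching {P κ : Type*} [PartialOrder P] [LinearOrder κ] (s : Finset P)
    (up : P → P) (φ : P → κ) {σ : P} (hσ : σ ∈ s) (hmin : ∀ τ ∈ s, σ ≤ τ)
    (hcov : ∀ τ ∈ s, τ ⋖ up τ) (hinj : Set.InjOn up s)
    (hdisj : ∀ τ ∈ s, up τ ∉ s)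
    (hlt : ∀ τ ∈ s, ∀ τ' ∈ s, τ < τ' → φ τ < φ τ')
    (hup : ∀ τ ∈ s, ∀ τ' ∈ s, τ ≠ τ' → τ < up τ' → φ τ < φ τ') :
    Collapsible (((s : Set P) ∪ up '' s) \ {σ}) := by
  classical
  have key : ∀ t : Finset P, t ⊆ s.erase σ →
      Relation.ReflTransGen ElementaryCollapse ((t : Set P) ∪ up '' t ∪ {up σ}) {up σ} := by
    intro t
    induction t using Finset.strongInduction with
    | H t ih =>
      intro hts
      have hmem : ∀ τ ∈ t, τ ∈ s ∧ τ ≠ σ := fun τ h =>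
        ⟨Finset.mem_of_mem_erase (hts h), Finset.ne_of_mem_erase (hts h)⟩
      rcases t.eq_empty_or_nonempty with rfl | hne
      · simpa using Relation.ReflTransGen.refl
      obtain ⟨τ, hτ, hmax⟩ := t.exists_max_image φ hne
      have hτs := (hmem τ hτ).1
      refine Relation.ReflTransGen.head ?_
        (ih (t.erase τ) (Finset.erase_ssubset hτ) ((Finset.erase_subset _ _).trans hts))
      -- With `τ` of maximal potential among the remaining lower cells, any cell above `τ` other
      -- than `up τ` would give a larger potential; so `τ` is free.
      refine ⟨τ, Or.inl (Or.inl hτ), up τ, Or.inl (Or.inr ⟨τ, hτ, rfl⟩), hcov τ hτs, ?_, ?_⟩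
      · rintro x ((hx | ⟨τ', hτ', rfl⟩) | rfl) hlx
        · exact absurd (hlt τ hτs x (hmem x hx).1 hlx) (not_lt.2 (hmax x hx))
        · by_contra hne'
          exact absurd (hup τ hτs τ' (hmem τ' hτ').1 (fun h => hne' (h ▸ rfl)) hlx)
            (not_lt.2 (hmax τ' hτ'))
        -- The cell `up σ` is never removed, but it cannot contain `τ` either: that would give `φ τ
        -- < φ σ`, whereas `σ < τ` gives the opposite.
        · exact absurd (hup τ hτs σ hσ (hmem τ hτ).2 hlx)
            (not_lt.2 (hlt σ hσ τ hτs (lt_of_le_of_ne (hmin τ hτs) (hmem τ hτ).2.symm)).le)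
      · ext x
        simp only [Set.mem_union, Set.mem_sdiff, Set.mem_insert_iff, Set.mem_singleton_iff,
          Finset.mem_coe, Finset.mem_erase, Set.mem_image, not_or]
        constructor
        · rintro ((⟨h1, h2⟩ | ⟨τ', ⟨h1, h2⟩, rfl⟩) | rfl)
          · exact ⟨Or.inl (Or.inl h2), h1, fun h => hdisj τ hτs (h ▸ (hmem x h2).1)⟩
          · exact ⟨Or.inl (Or.inr ⟨τ', h2, rfl⟩), fun h => hdisj τ' (hmem τ' h2).1 (h ▸ hτs),
              fun h => h1 (hinj (hmem τ' h2).1 hτs h)⟩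
          · exact ⟨Or.inr rfl, fun h => hdisj σ hσ (h ▸ hτs),
              fun h => (hmem τ hτ).2 (hinj hτs hσ h.symm)⟩
        · rintro ⟨(h | ⟨τ', h, rfl⟩) | rfl, h1, h2⟩
          · exact Or.inl (Or.inl ⟨h1, h⟩)
          · exact Or.inl (Or.inr ⟨τ', ⟨fun h' => h2 (h' ▸ rfl), h⟩, rfl⟩)
          · exact Or.inr rfl
  refine ⟨up σ, ?_⟩
  convert key (s.erase σ) subset_rfl using 1
  ext x
  simp only [Set.mem_union, Set.mem_sdiff, Set.mem_singleton_iff,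
    Finset.mem_coe, Finset.mem_erase, Set.mem_image]
  constructor
  · rintro ⟨h | ⟨τ, h, rfl⟩, h1⟩
    · exact Or.inl (Or.inl ⟨h1, h⟩)
    · by_cases h2 : τ = σ
      · exact Or.inr (h2 ▸ rfl)
      · exact Or.inl (Or.inr ⟨τ, ⟨h2, h⟩, rfl⟩)
  · rintro ((⟨h1, h⟩ | ⟨τ, ⟨h1, h⟩, rfl⟩) | rfl)
    · exact ⟨Or.inl h, h1⟩
    · exact ⟨Or.inr ⟨τ, h, rfl⟩, fun h' => hdisj τ h (h' ▸ hσ)⟩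
    · exact ⟨Or.inr ⟨σ, hσ, rfl⟩, fun h' => hdisj σ hσ (h'.symm ▸ hσ)⟩

/-! ### Missing letters and the sets obtained by adding one box for each -/

section Letters

variable {l m : ℕ} {T S : Finset (Box l m)}

/-- The letters that occur more than once in `S \ T`. -/
def heavyLetters (T S : Finset (Box l m)) : Finset (Fin m) :=
  Finset.univ.filter fun i => 1 < letterMultiplicity i (S \ T)

/-- The letters that occur more than once in `S \ T` but do not occur in `u \ T`. -/
def missing (T S u : Finset (Box l m)) : Finset (Fin m) :=
  (heavyLetters T S).filter fun i => ∀ b ∈ u, b.1 = i → b ∈ T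

/-- The set `x` together with one further box in each row that `x` misses. -/
def addBoxes (T S x : Finset (Box l m)) (a : Fin m → Fin l) : Finset (Box l m) :=
  x ∪ (missing T S x).image fun i => (i, a i)

theorem missing_anti {u v : Finset (Box l m)} (h : u ⊆ v) : missing T S v ⊆ missing T S u := by
  intro i hi
  rw [missing, Finset.mem_filter] at hi ⊢
  exact ⟨hi.1, fun b hb => hi.2 b (h hb)⟩

theorem missing_self : missing T S T = heavyLetters T S := by
  rw [missing, Finset.filter_eq_self]
  exact fun _ _ b hb _ => hb

theorem missing_eq_empty_of_subset {u : Finset (Box l m)} (h : S ⊆ u) : missing T S u = ∅ := by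
  rw [missing, Finset.filter_eq_empty_iff]
  intro i hi hall
  rw [heavyLetters, Finset.mem_filter, letterMultiplicity] at hi
  obtain ⟨b, hb⟩ := Finset.card_pos.1 (zero_lt_one.trans hi.2)
  rw [Finset.mem_filter, Finset.mem_sdiff] at hb
  exact hb.1.2 (hall b (h hb.1.1) hb.2)

theorem exists_box_of_missing_eq_empty {x z : Finset (Box l m)} (hl : Nonempty (Fin l))
    (hz : missing T S z = ∅) :
    ∃ a : Fin m → Fin l, ∀ i ∈ missing T S x, (i, a i) ∈ z ∧ (i, a i) ∉ T := by
  have h : ∀ i, ∃ j, i ∈ missing T S x → (i, j) ∈ z ∧ (i, j) ∉ T := by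
    intro i
    by_cases hi : i ∈ missing T S x
    · rw [missing, Finset.mem_filter] at hi
      have : i ∉ missing T S z := by simp [hz]
      rw [missing, Finset.mem_filter] at this
      push Not at this
      obtain ⟨⟨i', j⟩, hb, rfl, hbT⟩ := this hi.1
      exact ⟨j, fun _ => ⟨hb, hbT⟩⟩
    -- Rows that are not missing get an arbitrary column, which is never used.
    · exact ⟨hl.some, fun h => absurd h hi⟩
  choose a ha using h
  exact ⟨a, ha⟩

theorem notMem_of_missing {x : Finset (Box l m)} {i : Fin m} {j : Fin l}
    (hi : i ∈ missing T S x) (hj : (i, j) ∉ T) : (i, j) ∉ x := fun h =>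
  hj ((Finset.mem_filter.1 hi).2 _ h rfl)

theorem card_addBoxes {x : Finset (Box l m)} {a : Fin m → Fin l}
    (ha : ∀ i ∈ missing T S x, (i, a i) ∉ T) :
    (addBoxes T S x a).card = x.card + (missing T S x).card := by
  rw [addBoxes, Finset.card_union_of_disjoint, Finset.card_image_of_injective]
  · intro i i' h
    exact congrArg Prod.fst h
  · rw [Finset.disjoint_right]
    intro b hb
    obtain ⟨i, hi, rfl⟩ := Finset.mem_image.1 hb
    exact notMem_of_missing hi (ha i hi)

theorem addBoxes_subset {x z : Finset (Box l m)} {a : Fin m → Fin l} (hx : x ⊆ z)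
    (ha : ∀ i ∈ missing T S x, (i, a i) ∈ z) : addBoxes T S x a ⊆ z := by
  refine Finset.union_subset hx fun b hb => ?_
  obtain ⟨i, hi, rfl⟩ := Finset.mem_image.1 hb
  exact ha i hi

theorem missing_addBoxes {x : Finset (Box l m)} {a : Fin m → Fin l}
    (ha : ∀ i ∈ missing T S x, (i, a i) ∉ T) : missing T S (addBoxes T S x a) = ∅ := by
  rw [Finset.eq_empty_iff_forall_notMem]
  intro i hi
  have hx : i ∈ missing T S x := missing_anti Finset.subset_union_left hi
  exact ha i hx ((Finset.mem_filter.1 hi).2 _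
    (Finset.mem_union_right _ (Finset.mem_image_of_mem _ hx)) rfl)

/-- `z` contains some `addBoxes T S x a`. Applied to the pivot, this bounds every larger chain
element below by the target size. -/
theorem card_add_card_missing_le {x z : Finset (Box l m)} (hl : Nonempty (Fin l)) (hx : x ⊆ z)
    (hz : missing T S z = ∅) : x.card + (missing T S x).card ≤ z.card := by
  obtain ⟨a, ha⟩ := exists_box_of_missing_eq_empty (x := x) hl hz
  rw [← card_addBoxes fun i hi => (ha i hi).2]
  exact Finset.card_le_card (addBoxes_subset hx fun i hi => (ha i hi).1)

/-- `u` contains some `addBoxes T S x a`, and the sizes agree. So every set that the matching can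
insert has this form. -/
theorem exists_eq_addBoxes {x u : Finset (Box l m)} (hl : Nonempty (Fin l)) (hx : x ⊆ u)
    (hu : missing T S u = ∅) (hcard : u.card = x.card + (missing T S x).card) :
    ∃ a : Fin m → Fin l, (∀ i ∈ missing T S x, (i, a i) ∉ T) ∧ u = addBoxes T S x a := by
  obtain ⟨a, ha⟩ := exists_box_of_missing_eq_empty (x := x) hl hu
  refine ⟨a, fun i hi => (ha i hi).2, (Finset.eq_of_subset_of_card_le
    (addBoxes_subset hx fun i hi => (ha i hi).1) ?_).symm⟩
  rw [card_addBoxes fun i hi => (ha i hi).2, hcard]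

/-- A missing letter has at least two boxes in `S \ x`, so adding one of each leaves some box of `S`
unused. This is where multiplicity at least two, rather than one, is needed. -/
theorem card_add_card_missing_lt {x : Finset (Box l m)} (hx : x ⊆ S)
    (hne : (missing T S x).Nonempty) : x.card + (missing T S x).card < S.card := by
  have h2 : ∀ i ∈ missing T S x, 2 ≤ ((S \ x).filter fun b => b.1 = i).card := by
    intro i hi
    have hi' := Finset.mem_filter.1 hi
    refine le_trans (Finset.mem_filter.1 hi'.1).2 (Finset.card_le_card fun b hb => ?_)
    rw [Finset.mem_filter, Finset.mem_sdiff] at hb ⊢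
    exact ⟨⟨hb.1.1, fun h => hb.1.2 (hi'.2 b h hb.2)⟩, hb.2⟩
  have h3 : ∑ i ∈ missing T S x, ((S \ x).filter fun b => b.1 = i).card ≤ (S \ x).card :=
    (Finset.sum_card_fiberwise_eq_card_filter _ _ _).trans_le (Finset.card_filter_le _ _)
  have h4 := Finset.card_nsmul_le_sum _ _ _ h2
  have h5 := Finset.card_pos.2 hne
  have h6 := Finset.card_sdiff_add_card_eq_card hx
  rw [smul_eq_mul] at h4
  omega

/-- Exchanging one box for another in every row that `x` misses. -/
theorem exists_wreath_addBoxes {x : Finset (Box l m)} {a a' : Fin m → Fin l}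
    (ha : ∀ i ∈ missing T S x, (i, a i) ∉ T) (ha' : ∀ i ∈ missing T S x, (i, a' i) ∉ T) :
    ∃ h ∈ wreath l m, (addBoxes T S x a).image h = addBoxes T S x a' ∧
      (∀ v ⊆ x, v.image h = v) ∧
      ∀ v, addBoxes T S x a ⊆ v → addBoxes T S x a' ⊆ v → v.image h = v := by
  classical
  let h : Equiv.Perm (Box l m) := Equiv.prodShear (Equiv.refl _) fun i =>
    if i ∈ missing T S x then Equiv.swap (a i) (a' i) else 1
  have hrow : ∀ b, (h b).1 = b.1 := fun b => rfl
  have hx : ∀ b ∈ x, h b = b := by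
    rintro ⟨i, j⟩ hb
    refine Prod.ext rfl ?_
    change (if i ∈ missing T S x then Equiv.swap (a i) (a' i) else 1) j = j
    split_ifs with hi
    · refine Equiv.swap_apply_of_ne_of_ne ?_ ?_
      · rintro rfl
        exact notMem_of_missing hi (ha i hi) hb
      · rintro rfl
        exact notMem_of_missing hi (ha' i hi) hb
    · rfl
  have hsub : ∀ u v : Finset (Box l m), u.card = v.card → (∀ b ∈ u, h b ∈ v) → u.image h = v := by
    intro u v huv hb
    refine Finset.eq_of_subset_of_card_le (Finset.image_subset_iff.2 hb) ?_
    rw [Finset.card_image_of_injective _ h.injective, huv]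
  refine ⟨h, fun b b' => by rw [hrow, hrow], hsub _ _ ?_ ?_, fun v hv => hsub _ _ rfl ?_,
    fun v hv hv' => hsub _ _ rfl ?_⟩
  · rw [card_addBoxes ha, card_addBoxes ha']
  · intro b hb
    rcases Finset.mem_union.1 hb with hb | hb
    · rw [hx b hb]
      exact Finset.mem_union_left _ hb
    · obtain ⟨i, hi, rfl⟩ := Finset.mem_image.1 hb
      refine Finset.mem_union_right _ (Finset.mem_image.2 ⟨i, hi, Prod.ext rfl ?_⟩)
      change a' i = (if i ∈ missing T S x then Equiv.swap (a i) (a' i) else 1) (a i)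
      rw [if_pos hi, Equiv.swap_apply_left]
  · intro b hb
    rw [hx b (hv hb)]
    exact hb
  -- A set that contains both choices of boxes is closed under the swaps.
  · rintro ⟨i, j⟩ hb
    by_cases hi : i ∈ missing T S x
    · have hval : h (i, j) = (i, Equiv.swap (a i) (a' i) j) := by
        refine Prod.ext rfl ?_
        change (if i ∈ missing T S x then Equiv.swap (a i) (a' i) else 1) j = _
        rw [if_pos hi]
      rw [hval, Equiv.swap_apply_def]
      split_ifs
      · exact hv' (Finset.mem_union_right _ (Finset.mem_image.2 ⟨i, hi, rfl⟩))
      · exact hv (Finset.mem_union_right _ (Finset.mem_image.2 ⟨i, hi, rfl⟩))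
      · exact hb
    · have hval : h (i, j) = (i, j) := by
        refine Prod.ext rfl ?_
        change (if i ∈ missing T S x then Equiv.swap (a i) (a' i) else 1) j = _
        rw [if_neg hi]
        rfl
      rwa [hval]

/-- `g` induces an injection on letters, read off from any fixed column `j`. As `g` fixes `T` and
`S`, it preserves heaviness and carries missing letters to missing letters. -/
theorem card_missing_le_card_missing_image {g : Equiv.Perm (Box l m)} (hg : g ∈ wreath l m)
    (hl : Nonempty (Fin l)) (hT : T.image g = T) (hS : S.image g = S) (u : Finset (Box l m)) :
    (missing T S u).card ≤ (missing T S (u.image g)).card := by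
  obtain ⟨j⟩ := hl
  have hgT : ∀ b, g b ∈ T ↔ b ∈ T := fun b => by
    conv_lhs => rw [← hT]
    simp
  have hgS : ∀ b, g b ∈ S ↔ b ∈ S := fun b => by
    conv_lhs => rw [← hS]
    simp
  refine Finset.card_le_card_of_injOn (fun i => (g (i, j)).1) ?_ ?_
  · intro i hi
    rw [Finset.mem_coe, missing, Finset.mem_filter] at hi ⊢
    constructor
    · have h := hi.1
      rw [heavyLetters, Finset.mem_filter] at h ⊢
      refine ⟨Finset.mem_univ _, h.2.trans_le ?_⟩
      refine Finset.card_le_card_of_injOn g ?_ g.injective.injOn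
      intro b hb
      simp only [Finset.coe_filter, Finset.mem_sdiff, Set.mem_ofPred_eq, hgT, hgS] at hb ⊢
      exact ⟨hb.1, (hg b (i, j)).2 hb.2⟩
    · intro b hb hbi
      obtain ⟨b', hb', rfl⟩ := Finset.mem_image.1 hb
      exact (hgT b').2 (hi.2 b' hb' ((hg b' (i, j)).1 hbi))
  · intro i _ i' _ h
    exact (hg (i, j) (i', j)).1 h

theorem image_inv_image (g : Equiv.Perm (Box l m)) (u : Finset (Box l m)) :
    (u.image g).image (g⁻¹ : Equiv.Perm (Box l m)) = u := by
  simp [Finset.image_image]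

theorem card_missing_image {g : Equiv.Perm (Box l m)} (hg : g ∈ wreath l m)
    (hl : Nonempty (Fin l)) (hT : T.image g = T) (hS : S.image g = S) (u : Finset (Box l m)) :
    (missing T S (u.image g)).card = (missing T S u).card := by
  refine le_antisymm ?_ (card_missing_le_card_missing_image hg hl hT hS u)
  have h := card_missing_le_card_missing_image (T := T) (S := S) (inv_mem hg) hl
    (by rw [← hT, image_inv_image, hT]) (by rw [← hS, image_inv_image, hS]) (u.image g)
  rwa [image_inv_image] at h

end Letters

/-! ### Chains, their orbits and the face order -/

section Chains

variable {l m : ℕ} {T S : Finset (Box l m)} {c d d' e : ChainFace l m}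

namespace ChainFace

theorem mem_extended {u : Finset (Box l m)} :
    u ∈ d.extended ↔ u = ∅ ∨ u = Finset.univ ∨ u ∈ d.sets := by
  simp [extended]

theorem univ_mem_extended (d : ChainFace l m) : Finset.univ ∈ d.extended :=
  mem_extended.2 (Or.inr (Or.inl rfl))

theorem mem_extended_of_mem {u : Finset (Box l m)} (h : u ∈ d.sets) : u ∈ d.extended :=
  mem_extended.2 (Or.inr (Or.inr h))

theorem extended_mono (h : d.sets ⊆ d'.sets) : d.extended ⊆ d'.extended :=
  Finset.insert_subset_insert _ (Finset.insert_subset_insert _ h)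

theorem subset_or_subset {u v : Finset (Box l m)} (hu : u ∈ d.extended) (hv : v ∈ d.extended) :
    u ⊆ v ∨ v ⊆ u := by
  rcases mem_extended.1 hu with rfl | rfl | hu
  · exact Or.inl (Finset.empty_subset _)
  · exact Or.inr (Finset.subset_univ _)
  rcases mem_extended.1 hv with rfl | rfl | hv
  · exact Or.inr (Finset.empty_subset _)
  · exact Or.inl (Finset.subset_univ _)
  exact d.chain u hu v hv

theorem subset_of_card_le {u v : Finset (Box l m)} (hu : u ∈ d.extended) (hv : v ∈ d.extended)
    (h : u.card ≤ v.card) : u ⊆ v := by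
  rcases subset_or_subset hu hv with h' | h'
  · exact h'
  · exact (Finset.eq_of_subset_of_card_le h' h).symm.subset

theorem eq_of_card_eq {u v : Finset (Box l m)} (hu : u ∈ d.extended) (hv : v ∈ d.extended)
    (h : u.card = v.card) : u = v :=
  (subset_of_card_le hu hv h.le).antisymm (subset_of_card_le hv hu h.ge)

theorem image_mem_extended {g : Equiv.Perm (Box l m)} (h : permSets g d.sets ⊆ d'.sets)
    {u : Finset (Box l m)} (hu : u ∈ d.extended) : u.image g ∈ d'.extended := by
  rcases mem_extended.1 hu with rfl | rfl | hu
  · simp [extended]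
  · rw [Finset.image_univ_of_surjective g.surjective]
    exact univ_mem_extended _
  · exact mem_extended_of_mem (h (Finset.mem_image_of_mem _ hu))

/-- A permutation between two chains fixes every element of a common subchain. -/
theorem image_eq_of_mem_extended {g : Equiv.Perm (Box l m)} (hd : c.sets ⊆ d.sets)
    (hd' : c.sets ⊆ d'.sets) (h : permSets g d.sets ⊆ d'.sets) {u : Finset (Box l m)}
    (hu : u ∈ c.extended) : u.image g = u :=
  eq_of_card_eq (image_mem_extended h (extended_mono hd hu)) (extended_mono hd' hu)
    (Finset.card_image_of_injective _ g.injective)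

theorem ext_sets (h : d.sets = d'.sets) : d = d' := by
  cases d
  cases d'
  congr

/-- The image of a chain under a permutation of the boxes. -/
def perm (g : Equiv.Perm (Box l m)) (d : ChainFace l m) : ChainFace l m where
  sets := permSets g d.sets
  proper := by
    intro u hu
    obtain ⟨v, hv, rfl⟩ := Finset.mem_image.1 hu
    refine ⟨fun h => (d.proper v hv).1 (Finset.image_eq_empty.1 h), fun h => (d.proper v hv).2 ?_⟩
    refine Finset.image_injective g.injective ?_
    rw [h, Finset.image_univ_of_surjective g.surjective]
  chain := by
    intro u hu v hv
    obtain ⟨u', hu', rfl⟩ := Finset.mem_image.1 hu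
    obtain ⟨v', hv', rfl⟩ := Finset.mem_image.1 hv
    exact (d.chain u' hu' v' hv').imp Finset.image_subset_image Finset.image_subset_image

theorem orbit_perm {g : Equiv.Perm (Box l m)} (hg : g ∈ wreath l m) (d : ChainFace l m) :
    (d.perm g).orbit = d.orbit :=
  (Quotient.sound ⟨g, hg, rfl⟩ : d.orbit = (d.perm g).orbit).symm

theorem orbit_le_orbit : d.orbit ≤ d'.orbit ↔ ∃ g ∈ wreath l m, permSets g d.sets ⊆ d'.sets :=
  Iff.rfl

theorem orbit_eq_orbit : d.orbit = d'.orbit ↔ ∃ g ∈ wreath l m, permSets g d.sets = d'.sets :=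
  Quotient.eq

theorem exists_rep {q : QuotientFace l m} (h : c.orbit ≤ q) :
    ∃ d : ChainFace l m, c.sets ⊆ d.sets ∧ d.orbit = q := by
  induction q using Quotient.inductionOn with
  | h d =>
    obtain ⟨g, hg, h⟩ := orbit_le_orbit.1 h
    refine ⟨d.perm g⁻¹, ?_, orbit_perm (inv_mem hg) d⟩
    have := permSets_mono g⁻¹ h
    rwa [permSets_inv rfl] at this

theorem orbit_le_of_subset (h : d.sets ⊆ d'.sets) : d.orbit ≤ d'.orbit :=
  orbit_le_orbit.2 ⟨1, one_mem _, by rwa [permSets_one]⟩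

theorem card_le_of_orbit_le (h : d.orbit ≤ d'.orbit) : d.sets.card ≤ d'.sets.card := by
  obtain ⟨g, -, h⟩ := orbit_le_orbit.1 h
  rw [← card_permSets g d.sets]
  exact Finset.card_le_card h

theorem card_lt_of_orbit_lt (h : d.orbit < d'.orbit) : d.sets.card < d'.sets.card := by
  obtain ⟨g, hg, h'⟩ := orbit_le_orbit.1 h.le
  rw [← card_permSets g d.sets]
  refine Finset.card_lt_card (h'.ssubset_of_ne fun heq => h.ne ?_)
  exact orbit_eq_orbit.2 ⟨g, hg, heq⟩

/-- The number of sets is strictly monotone on orbits, so a difference of one leaves no room in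
between. -/
theorem covBy_of_insert {u : Finset (Box l m)} (hu : u ∉ d.sets)
    (h : d'.sets = insert u d.sets) : d.orbit ⋖ d'.orbit := by
  have hcard : d'.sets.card = d.sets.card + 1 := by rw [h, Finset.card_insert_of_notMem hu]
  refine ⟨lt_of_le_of_ne (orbit_le_of_subset (h ▸ Finset.subset_insert _ _)) fun heq => ?_, ?_⟩
  · have := card_le_of_orbit_le heq.ge
    omega
  · intro q h1 h2
    induction q using Quotient.inductionOn with
    | h f =>
      have h1 := card_lt_of_orbit_lt (d' := f) h1
      have h2 := card_lt_of_orbit_lt (d := f) h2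
      omega

theorem finite_quotientFace (l m : ℕ) : Finite (QuotientFace l m) := by
  have : Finite (ChainFace l m) :=
    Finite.of_injective ChainFace.sets fun _ _ h => ext_sets h
  exact Quotient.finite _

/-! ### The pivot and its invariance -/

/-- `x` is the largest element of the extended chain that misses a letter. -/
def IsPivot (T S : Finset (Box l m)) (d : ChainFace l m) (x : Finset (Box l m)) : Prop :=
  x ∈ d.extended ∧ (missing T S x).Nonempty ∧
    ∀ v ∈ d.extended, (missing T S v).Nonempty → v.card ≤ x.card

open Classical in
/-- The largest element of the extended chain that misses a letter. -/
noncomputable def pivot (T S : Finset (Box l m)) (d : ChainFace l m) : Finset (Box l m) :=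
  if h : ∃ x, IsPivot T S d x then h.choose else ∅

/-- The size of the sets obtained from the pivot by adding one box for each missing letter. -/
noncomputable def target (T S : Finset (Box l m)) (d : ChainFace l m) : ℕ :=
  (pivot T S d).card + (missing T S (pivot T S d)).card

theorem isPivot_pivot (hT : T ∈ d.extended) (hrep : (heavyLetters T S).Nonempty) :
    IsPivot T S d (pivot T S d) := by
  have h : ∃ x, IsPivot T S d x := by
    classical
    obtain ⟨x, hx, hmax⟩ := (d.extended.filter fun v => (missing T S v).Nonempty).exists_max_image
      Finset.card ⟨T, Finset.mem_filter.2 ⟨hT, by rwa [missing_self]⟩⟩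
    rw [Finset.mem_filter] at hx
    exact ⟨x, hx.1, hx.2, fun v hv hv' => hmax v (Finset.mem_filter.2 ⟨hv, hv'⟩)⟩
  rw [pivot, dif_pos h]
  exact h.choose_spec

theorem IsPivot.eq_pivot {x : Finset (Box l m)} (h : IsPivot T S d x) : x = pivot T S d := by
  have h' : ∃ x, IsPivot T S d x := ⟨x, h⟩
  rw [pivot, dif_pos h']
  have := h'.choose_spec
  exact eq_of_card_eq h.1 this.1 ((this.2.2 x h.1 h.2.1).antisymm (h.2.2 _ this.1 this.2.1))

theorem IsPivot.missing_eq_empty {x v : Finset (Box l m)} (h : IsPivot T S d x)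
    (hv : v ∈ d.extended) (hlt : x.card < v.card) : missing T S v = ∅ := by
  by_contra hne
  exact absurd (h.2.2 v hv (Finset.nonempty_iff_ne_empty.2 hne)) (not_le.2 hlt)

/-- The number of letters missing from the pivot is positive, and the target size lies strictly
between the sizes of `T` and `S`. -/
theorem target_bounds (hT : T ∈ d.extended) (hS : S ∈ d.extended)
    (hrep : (heavyLetters T S).Nonempty) :
    T.card ≤ (pivot T S d).card ∧ (pivot T S d).card < target T S d ∧
      target T S d < S.card := by
  have h := isPivot_pivot hT hrep
  refine ⟨h.2.2 T hT (by rwa [missing_self]), ?_, card_add_card_missing_lt ?_ h.2.1⟩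
  · have := Finset.card_pos.2 h.2.1
    rw [target]
    omega
  · rcases subset_or_subset h.1 hS with h' | h'
    · exact h'
    · have := missing_eq_empty_of_subset (T := T) h'
      exact absurd this (Finset.nonempty_iff_ne_empty.1 h.2.1)

/-- The image of the pivot of `d` misses as many letters as the pivot itself, so it competes for the
pivot of `d'`. If the sizes agree, it is that pivot, since a chain has at most one element of each
size. -/
theorem card_pivot_le {g : Equiv.Perm (Box l m)} (hg : g ∈ wreath l m) (hl : Nonempty (Fin l))
    (hgT : T.image g = T) (hgS : S.image g = S) (h : permSets g d.sets ⊆ d'.sets)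
    (hT : T ∈ d.extended) (hT' : T ∈ d'.extended) (hrep : (heavyLetters T S).Nonempty) :
    (pivot T S d).card ≤ (pivot T S d').card ∧
      ((pivot T S d).card = (pivot T S d').card →
        (pivot T S d).image g = pivot T S d' ∧ target T S d = target T S d') := by
  have hp := isPivot_pivot hT hrep
  have hp' := isPivot_pivot hT' hrep
  have hmem := image_mem_extended h hp.1
  have hcard : ((pivot T S d).image g).card = (pivot T S d).card :=
    Finset.card_image_of_injective _ g.injective
  have hmiss := card_missing_image hg hl hgT hgS (pivot T S d)
  refine ⟨?_, fun heq => ?_⟩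
  · rw [← hcard]
    refine hp'.2.2 _ hmem (Finset.card_pos.1 ?_)
    rw [hmiss]
    exact Finset.card_pos.2 hp.2.1
  · have := eq_of_card_eq hmem hp'.1 (hcard.trans heq)
    refine ⟨this, ?_⟩
    rw [target, target, ← hmiss, this, heq]

theorem pivot_eq_of_permSets_eq {g : Equiv.Perm (Box l m)} (hg : g ∈ wreath l m)
    (hl : Nonempty (Fin l))
    (hgT : T.image g = T) (hgS : S.image g = S) (h : permSets g d.sets = d'.sets)
    (hT : T ∈ d.extended) (hT' : T ∈ d'.extended) (hrep : (heavyLetters T S).Nonempty) :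
    (pivot T S d).image g = pivot T S d' ∧ target T S d = target T S d' := by
  have h1 := card_pivot_le hg hl hgT hgS h.subset hT hT' hrep
  have h2 := card_pivot_le (inv_mem hg) hl (by rw [← hgT, image_inv_image, hgT])
    (by rw [← hgS, image_inv_image, hgS]) (permSets_inv h).subset hT' hT hrep
  exact h1.2 (h1.1.antisymm h2.1)

/-! ### The matching on chains -/

/-- `d'` arises from `d` by adding a set above the pivot that has one more box for each letter
missing from the pivot. -/
def IsUp (T S : Finset (Box l m)) (d d' : ChainFace l m) : Prop :=
  ∃ u, u ∉ d.extended ∧ d'.sets = insert u d.sets ∧ u.card = target T S d ∧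
    pivot T S d' = pivot T S d

/-- The chain has no element of the target size. -/
def IsLower (T S : Finset (Box l m)) (d : ChainFace l m) : Prop :=
  ∀ u ∈ d.extended, u.card ≠ target T S d

theorem IsUp.subset (h : IsUp T S d d') : d.sets ⊆ d'.sets := by
  obtain ⟨u, -, h, -⟩ := h
  exact h ▸ Finset.subset_insert _ _

theorem IsUp.covBy (h : IsUp T S d d') : d.orbit ⋖ d'.orbit := by
  obtain ⟨u, hu, h, -⟩ := h
  exact covBy_of_insert (fun h' => hu (mem_extended_of_mem h')) h

theorem IsUp.target_eq (h : IsUp T S d d') : target T S d' = target T S d := by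
  obtain ⟨u, -, -, -, h⟩ := h
  rw [target, target, h]

theorem IsUp.not_isLower (h : IsUp T S d d') : ¬ IsLower T S d' := by
  intro h'
  have ht := h.target_eq
  obtain ⟨u, -, h, hu, -⟩ := h
  exact h' u (mem_extended_of_mem (h ▸ Finset.mem_insert_self _ _)) (hu.trans ht.symm)

theorem IsUp.isLower (h : IsUp T S d d') : IsLower T S d := by
  obtain ⟨u, hu, h, hcard, -⟩ := h
  intro v hv hv'
  have hud : u ∈ d'.extended := mem_extended_of_mem (h ▸ Finset.mem_insert_self _ _)
  have hvd : v ∈ d'.extended := extended_mono (h ▸ Finset.subset_insert _ _) hv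
  exact hu (eq_of_card_eq hud hvd (hcard.trans hv'.symm) ▸ hv)

/-- The chain element `z` next above the pivot misses no letter, so it supplies the boxes to add.
The new set lies between the pivot and `z` and misses no letter, hence the pivot stays the same. -/
theorem IsLower.exists_isUp (hl : Nonempty (Fin l)) (hT : T ∈ d.extended)
    (hrep : (heavyLetters T S).Nonempty) (h : IsLower T S d) : ∃ d', IsUp T S d d' := by
  classical
  have hp := isPivot_pivot hT hrep
  set x := pivot T S d with hx
  have hfull : x.card < (Finset.univ : Finset (Box l m)).card := by
    refine Finset.card_lt_card (Finset.ssubset_univ_iff.2 fun h => ?_)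
    have := hp.2.1
    rw [h, missing_eq_empty_of_subset (Finset.subset_univ _)] at this
    exact Finset.not_nonempty_empty this
  obtain ⟨z, hz, hmin⟩ := (d.extended.filter fun v => x.card < v.card).exists_min_image
    Finset.card ⟨_, Finset.mem_filter.2 ⟨univ_mem_extended d, hfull⟩⟩
  rw [Finset.mem_filter] at hz
  have hxz : x ⊆ z := subset_of_card_le hp.1 hz.1 hz.2.le
  obtain ⟨a, ha⟩ := exists_box_of_missing_eq_empty (x := x) hl (hp.missing_eq_empty hz.1 hz.2)
  have haT : ∀ i ∈ missing T S x, (i, a i) ∉ T := fun i hi => (ha i hi).2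
  have hxu : x ⊆ addBoxes T S x a := Finset.subset_union_left
  have huz : addBoxes T S x a ⊆ z := addBoxes_subset hxz fun i hi => (ha i hi).1
  have hcard : (addBoxes T S x a).card = target T S d := card_addBoxes haT
  have hmiss := missing_addBoxes haT
  have hu : addBoxes T S x a ∉ d.extended := fun hu => h _ hu hcard
  have hcomp : ∀ v ∈ d.extended, v ⊆ addBoxes T S x a ∨ addBoxes T S x a ⊆ v := by
    intro v hv
    by_cases hvx : x.card < v.card
    · exact Or.inr (huz.trans
        (subset_of_card_le hz.1 hv (hmin v (Finset.mem_filter.2 ⟨hv, hvx⟩))))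
    · exact Or.inl ((subset_of_card_le hv hp.1 (not_lt.1 hvx)).trans hxu)
  let d' : ChainFace l m :=
    { sets := insert (addBoxes T S x a) d.sets
      proper := by
        intro v hv
        rcases Finset.mem_insert.1 hv with rfl | hv
        · exact ⟨fun h => hu (mem_extended.2 (Or.inl h)),
            fun h => hu (mem_extended.2 (Or.inr (Or.inl h)))⟩
        · exact d.proper v hv
      chain := by
        intro v hv w hw
        rcases Finset.mem_insert.1 hv with rfl | hv <;> rcases Finset.mem_insert.1 hw with rfl | hw
        · exact Or.inl subset_rfl
        · exact (hcomp w (mem_extended_of_mem hw)).symm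
        · exact hcomp v (mem_extended_of_mem hv)
        · exact d.chain v hv w hw }
  have hd' : ∀ v ∈ d'.extended, v = addBoxes T S x a ∨ v ∈ d.extended := by
    intro v hv
    rcases mem_extended.1 hv with h | h | h
    · exact Or.inr (mem_extended.2 (Or.inl h))
    · exact Or.inr (mem_extended.2 (Or.inr (Or.inl h)))
    · exact (Finset.mem_insert.1 h).imp id mem_extended_of_mem
  refine ⟨d', addBoxes T S x a, hu, rfl, hcard, (IsPivot.eq_pivot ?_).symm⟩
  refine ⟨extended_mono (Finset.subset_insert _ _) hp.1, hp.2.1, fun v hv hne => ?_⟩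
  rcases hd' v hv with rfl | hv
  · rw [hmiss] at hne
    exact absurd hne Finset.not_nonempty_empty
  · exact hp.2.2 v hv hne

/-- Delete the element of target size. Its size is strictly between those of `T` and `S`, so it is
not in `c`; it is larger than the pivot, so the pivot survives. -/
theorem exists_isUp_of_not_isLower (hT : T ∈ d.extended) (hS : S ∈ d.extended)
    (hrep : (heavyLetters T S).Nonempty) (hcd : c.sets ⊆ d.sets)
    (hgap : ∀ u ∈ c.extended, u.card ≤ T.card ∨ S.card ≤ u.card) (h : ¬ IsLower T S d) :
    ∃ d₀, c.sets ⊆ d₀.sets ∧ IsUp T S d₀ d := by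
  classical
  rw [IsLower] at h
  push Not at h
  obtain ⟨u, hu, hcard⟩ := h
  have hb := target_bounds hT hS hrep
  have huc : u ∉ c.extended := fun huc => by
    have := hgap u huc
    omega
  have hud : u ∈ d.sets := by
    rcases mem_extended.1 hu with h | h | h
    · exact absurd (mem_extended.2 (Or.inl h)) huc
    · exact absurd (mem_extended.2 (Or.inr (Or.inl h))) huc
    · exact h
  let d₀ : ChainFace l m :=
    { sets := d.sets.erase u
      proper := fun v hv => d.proper v (Finset.mem_of_mem_erase hv)
      chain := fun v hv w hw => d.chain v (Finset.mem_of_mem_erase hv) w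
        (Finset.mem_of_mem_erase hw) }
  have hd₀ : d₀.sets ⊆ d.sets := Finset.erase_subset _ _
  have hc₀ : c.sets ⊆ d₀.sets := fun v hv => Finset.mem_erase.2
    ⟨fun h => huc (h ▸ mem_extended_of_mem hv), hcd hv⟩
  have hu₀ : u ∉ d₀.extended := by
    intro h
    rcases mem_extended.1 h with h | h | h
    · exact huc (mem_extended.2 (Or.inl h))
    · exact huc (mem_extended.2 (Or.inr (Or.inl h)))
    · exact Finset.notMem_erase _ _ h
  have hp := isPivot_pivot hT hrep
  have hpiv : pivot T S d = pivot T S d₀ := by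
    refine IsPivot.eq_pivot ⟨?_, hp.2.1, fun v hv => hp.2.2 v (extended_mono hd₀ hv)⟩
    rcases mem_extended.1 hp.1 with h | h | h
    · exact mem_extended.2 (Or.inl h)
    · exact mem_extended.2 (Or.inr (Or.inl h))
    · refine mem_extended_of_mem (Finset.mem_erase.2 ⟨fun heq => ?_, h⟩)
      rw [heq] at hb
      omega
  refine ⟨d₀, hc₀, u, hu₀, (Finset.insert_erase hud).symm, ?_, hpiv⟩
  rw [hcard, target, target, hpiv]

/-- Both inserted sets are the pivot plus one box per missing letter. Chain elements up to the pivot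
lie below both of them and all others contain both, so the row swaps of `exists_wreath_addBoxes` fix
the whole of `d`. -/
theorem IsUp.orbit_eq (hl : Nonempty (Fin l)) (hT : T ∈ d.extended)
    (hrep : (heavyLetters T S).Nonempty) (h : IsUp T S d d') (h' : IsUp T S d e) :
    d'.orbit = e.orbit := by
  have hlow := h.isLower
  have hp := isPivot_pivot hT hrep
  have key : ∀ {f u}, u ∉ d.extended → f.sets = insert u d.sets → u.card = target T S d →
      pivot T S f = pivot T S d →
      (∃ a : Fin m → Fin l, (∀ i ∈ missing T S (pivot T S d), (i, a i) ∉ T) ∧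
        u = addBoxes T S (pivot T S d) a) ∧
      ∀ v ∈ d.extended, (pivot T S d).card < v.card → u ⊆ v := by
    intro f u hu hf hcard hpf
    have hmono : d.extended ⊆ f.extended := extended_mono (hf ▸ Finset.subset_insert _ _)
    have huf : u ∈ f.extended := mem_extended_of_mem (hf ▸ Finset.mem_insert_self _ _)
    have hpos := Finset.card_pos.2 hp.2.1
    have hlt : (pivot T S d).card < u.card := by
      rw [hcard, target]
      omega
    have hpf' := isPivot_pivot (hmono hT) hrep
    rw [hpf] at hpf'
    refine ⟨exists_eq_addBoxes hl (subset_of_card_le hpf'.1 huf hlt.le)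
      (hpf'.missing_eq_empty huf hlt) hcard, fun v hv hlt' => ?_⟩
    refine subset_of_card_le huf (hmono hv) ?_
    rw [hcard]
    exact card_add_card_missing_le hl (subset_of_card_le hp.1 hv hlt'.le)
      (hp.missing_eq_empty hv hlt')
  obtain ⟨u, hu, hd', hcard, hpiv⟩ := h
  obtain ⟨u', hu', he, hcard', hpiv'⟩ := h'
  obtain ⟨⟨a, ha, rfl⟩, hv⟩ := key hu hd' hcard hpiv
  obtain ⟨⟨a', ha', rfl⟩, hv'⟩ := key hu' he hcard' hpiv'
  obtain ⟨g, hg, hgu, hg1, hg2⟩ := exists_wreath_addBoxes ha ha'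
  refine orbit_eq_orbit.2 ⟨g, hg, ?_⟩
  rw [hd', he, permSets, Finset.image_insert, hgu]
  congr 1
  conv_rhs => rw [← Finset.image_id (s := d.sets)]
  refine Finset.image_congr fun v hvd => ?_
  have hvd := mem_extended_of_mem hvd
  by_cases hlt : (pivot T S d).card < v.card
  · exact hg2 v (hv v hvd hlt) (hv' v hvd hlt)
  · exact hg1 v (subset_of_card_le hvd hp.1 (not_lt.1 hlt))

theorem IsUp.perm {g : Equiv.Perm (Box l m)} (hg : g ∈ wreath l m) (hl : Nonempty (Fin l))
    (hgT : T.image g = T) (hgS : S.image g = S) (hT : T ∈ d.extended)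
    (hrep : (heavyLetters T S).Nonempty) (h : IsUp T S d d') :
    IsUp T S (d.perm g) (d'.perm g) := by
  have hTg : ∀ {f : ChainFace l m}, T ∈ f.extended → T ∈ (f.perm g).extended := fun {f} hf => by
    have := image_mem_extended (d' := f.perm g) (g := g) subset_rfl hf
    rwa [hgT] at this
  have hTd' := extended_mono h.subset hT
  have h1 := pivot_eq_of_permSets_eq hg hl hgT hgS (d' := d.perm g) rfl hT (hTg hT) hrep
  have h2 := pivot_eq_of_permSets_eq hg hl hgT hgS (d' := d'.perm g) rfl hTd' (hTg hTd') hrep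
  obtain ⟨u, hu, hd', hcard, hpiv⟩ := h
  refine ⟨u.image g, fun hmem => hu ?_, ?_, ?_, ?_⟩
  · have := image_mem_extended (d' := d) (permSets_inv (g := g) (c := d.sets) rfl).subset hmem
    rwa [image_inv_image] at this
  · change permSets g d'.sets = _
    rw [hd', permSets, Finset.image_insert]
    rfl
  · rw [Finset.card_image_of_injective _ g.injective, hcard, h1.2]
  · rw [← h1.1, ← h2.1, hpiv]

end ChainFace

end Chains

/-! ### The matching on orbits and the collapse -/

open ChainFace in
theorem proposition4p2 (l m : ℕ) (c : ChainFace l m) (T S : Finset (Box l m))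
    (hc : c.OmitsSingleInterval T S)
    (hrep : ∃ i : Fin m, 1 < letterMultiplicity i (S \ T)) :
    Collapsible (link c.orbit) := by
  classical
  obtain ⟨hTc, hSc, -, hranks⟩ := hc
  have hgap : ∀ u ∈ c.extended, u.card ≤ T.card ∨ S.card ≤ u.card := fun u hu => by
    refine (hranks u.card ?_).1 ⟨u, hu, rfl⟩
    have h := u.card_le_univ
    rwa [Fintype.card_prod, Fintype.card_fin, Fintype.card_fin, mul_comm] at h
  obtain ⟨hl, hrep⟩ : Nonempty (Fin l) ∧ (heavyLetters T S).Nonempty := by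
    obtain ⟨i, hi⟩ := hrep
    obtain ⟨b, -⟩ := Finset.card_pos.1 (zero_lt_one.trans hi)
    exact ⟨⟨b.2⟩, i, Finset.mem_filter.2 ⟨Finset.mem_univ _, hi⟩⟩
  have hT : ∀ {d : ChainFace l m}, c.sets ⊆ d.sets → T ∈ d.extended := fun h =>
    extended_mono h hTc
  have hS : ∀ {d : ChainFace l m}, c.sets ⊆ d.sets → S ∈ d.extended := fun h =>
    extended_mono h hSc
  -- Chosen representatives that contain `c`, and chosen partners.
  have hrepr : ∀ q : QuotientFace l m, ∃ d : ChainFace l m, c.sets ⊆ d.sets ∧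
      (c.orbit ≤ q → d.orbit = q) := fun q => by
    by_cases h : c.orbit ≤ q
    · obtain ⟨d, hd, hq⟩ := exists_rep h
      exact ⟨d, hd, fun _ => hq⟩
    · exact ⟨c, subset_rfl, fun h' => absurd h' h⟩
  choose R hR hRq using hrepr
  have hpartner : ∀ q : QuotientFace l m, ∃ e : ChainFace l m,
      IsLower T S (R q) → IsUp T S (R q) e := fun q => by
    by_cases h : IsLower T S (R q)
    · obtain ⟨e, he⟩ := h.exists_isUp hl (hT (hR q)) hrep
      exact ⟨e, fun _ => he⟩
    · exact ⟨c, fun h' => absurd h' h⟩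
  choose U hU using hpartner
  have hpiv : ∀ {d e : ChainFace l m} {g : Equiv.Perm (Box l m)}, c.sets ⊆ d.sets →
      c.sets ⊆ e.sets → g ∈ wreath l m → permSets g d.sets ⊆ e.sets →
      (pivot T S d).card ≤ (pivot T S e).card ∧
      ((pivot T S d).card = (pivot T S e).card → target T S d = target T S e) := by
    intro d e g hd he hg h
    have := card_pivot_le hg hl (image_eq_of_mem_extended hd he h hTc)
      (image_eq_of_mem_extended hd he h hSc) h (hT hd) (hT he) hrep
    exact ⟨this.1, fun h' => (this.2 h').2⟩
  -- Matching commutes with passing to orbits: the chosen representative and the chosen partner do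
  -- not matter.
  have hup_orbit : ∀ {d e : ChainFace l m}, c.sets ⊆ d.sets → IsUp T S d e →
      IsLower T S (R d.orbit) ∧ (U d.orbit).orbit = e.orbit := by
    intro d e hd hde
    have hq : c.orbit ≤ d.orbit := orbit_le_of_subset hd
    obtain ⟨g, hg, h⟩ := orbit_eq_orbit.1 (hRq d.orbit hq).symm
    have hperm := hde.perm hg hl (image_eq_of_mem_extended hd (hR _) h.subset hTc)
      (image_eq_of_mem_extended hd (hR _) h.subset hSc) (hT hd) hrep
    rw [show d.perm g = R d.orbit from ext_sets h] at hperm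
    refine ⟨hperm.isLower, ?_⟩
    rw [(hU _ hperm.isLower).orbit_eq hl (hT (hR _)) hrep hperm, orbit_perm hg]
  have hnotUp : ∀ {d e : ChainFace l m}, c.sets ⊆ d.sets → IsUp T S d e →
      ¬ IsLower T S (R e.orbit) := by
    intro d e hd hde h
    have he := hd.trans hde.subset
    obtain ⟨f, hf⟩ := h.exists_isUp hl (hT (hR _)) hrep
    obtain ⟨g, hg, h'⟩ := orbit_eq_orbit.1 (hRq e.orbit (orbit_le_of_subset he))
    have := hf.perm hg hl (image_eq_of_mem_extended (hR _) he h'.subset hTc)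
      (image_eq_of_mem_extended (hR _) he h'.subset hSc) (hT (hR _)) hrep
    rw [show (R e.orbit).perm g = e from ext_sets h'] at this
    exact hde.not_isLower this.isLower
  have := finite_quotientFace l m
  let s : Finset (QuotientFace l m) :=
    (Set.toFinite {q | c.orbit ≤ q ∧ IsLower T S (R q)}).toFinset
  have hs : ∀ {q}, q ∈ s ↔ c.orbit ≤ q ∧ IsLower T S (R q) := fun {q} => by simp [s]
  have hUq : ∀ q ∈ s, IsUp T S (R q) (U q) := fun q hq => hU q (hs.1 hq).2
  have hUc : ∀ q ∈ s, c.sets ⊆ (U q).sets := fun q hq => (hR q).trans (hUq q hq).subset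
  have hRs : ∀ q ∈ s, (R q).orbit = q := fun q hq => hRq q (hs.1 hq).1
  -- The pivot size comes first because matching leaves it unchanged; the number of sets breaks
  -- ties.
  let φ : QuotientFace l m → ℕ ×ₗ ℕ := fun q =>
    toLex ((pivot T S (R q)).card, (R q).sets.card)
  have hφ : ∀ q ∈ s, ∀ q' ∈ s, (pivot T S (R q)).card ≤ (pivot T S (R q')).card →
      ((pivot T S (R q)).card = (pivot T S (R q')).card →
        (R q).sets.card < (R q').sets.card) → φ q < φ q' := by
    intro q _ q' _ h1 h2
    rw [Prod.Lex.toLex_lt_toLex]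
    rcases h1.lt_or_eq with h | h
    · exact Or.inl h
    · exact Or.inr ⟨h, h2 h⟩
  -- `c` has no set of size strictly between those of `T` and `S`, where the target size lies.
  have hcs : c.orbit ∈ s := by
    refine hs.2 ⟨le_rfl, ?_⟩
    obtain ⟨g, hg, h⟩ := orbit_eq_orbit.1 (hRq c.orbit le_rfl)
    have hRc : R c.orbit = c := ext_sets
      (Finset.eq_of_subset_of_card_le (hR _) (by rw [← h, card_permSets])).symm
    rw [hRc]
    intro u hu hcard
    have hb := target_bounds hTc hSc hrep
    have := hgap u hu
    omega
  have hmatch := collapsible_of_matching s (fun q => (U q).orbit) φ hcs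
    (fun q hq => (hs.1 hq).1) ?_ ?_ ?_ ?_ ?_
  · convert hmatch using 1
    ext q
    simp only [link, Set.mem_Ioi, Set.mem_sdiff, Set.mem_union, Finset.mem_coe, Set.mem_image,
      Set.mem_singleton_iff]
    constructor
    · intro hq
      refine ⟨?_, hq.ne'⟩
      by_cases h : IsLower T S (R q)
      · exact Or.inl (hs.2 ⟨hq.le, h⟩)
      · obtain ⟨d, hcd, hd⟩ := exists_isUp_of_not_isLower (hT (hR q)) (hS (hR q)) hrep (hR q)
          hgap h
        have hdq := hup_orbit hcd hd
        exact Or.inr ⟨d.orbit, hs.2 ⟨orbit_le_of_subset hcd, hdq.1⟩,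
          hdq.2.trans (hRq q hq.le)⟩
    · rintro ⟨h | ⟨q, hq, rfl⟩, hne⟩
      · exact lt_of_le_of_ne (hs.1 h).1 (Ne.symm hne)
      · exact lt_of_le_of_ne (orbit_le_of_subset (hUc q hq)) (Ne.symm hne)
  · intro q hq
    have := (hUq q hq).covBy
    rwa [hRs q hq] at this
  · intro q hq q' hq' heq
    obtain ⟨g, hg, h⟩ := orbit_eq_orbit.1 heq
    have hg' := fun {u} => image_eq_of_mem_extended (u := u) (hUc q hq) (hUc q' hq') h.subset
    have htar := (pivot_eq_of_permSets_eq hg hl (hg' hTc) (hg' hSc) h (hT (hUc q hq))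
      (hT (hUc q' hq')) hrep).2
    rw [(hUq q hq).target_eq, (hUq q' hq').target_eq] at htar
    obtain ⟨u, hu, hUu, hcard, -⟩ := hUq q hq
    obtain ⟨u', hu', hUu', hcard', -⟩ := hUq q' hq'
    -- Both sets have the common target size in one chain, so they coincide; deleting them shows
    -- that `g` carries `R q` to `R q'`.
    have hgu : u.image g = u' := by
      refine eq_of_card_eq (d := U q') (image_mem_extended h.subset (mem_extended_of_mem ?_))
        (mem_extended_of_mem ?_) ?_
      · exact hUu ▸ Finset.mem_insert_self _ _
      · exact hUu' ▸ Finset.mem_insert_self _ _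
      · rw [Finset.card_image_of_injective _ g.injective, hcard, hcard', htar]
    rw [← hRs q hq, ← hRs q' hq']
    refine orbit_eq_orbit.2 ⟨g, hg, ?_⟩
    have hu₁ : u ∉ (R q).sets := fun h => hu (mem_extended_of_mem h)
    have hu₂ : u' ∉ (R q').sets := fun h => hu' (mem_extended_of_mem h)
    rw [← Finset.erase_insert hu₁, ← Finset.erase_insert hu₂, ← hUu, ← hUu', ← h, ← hgu]
    exact Finset.image_erase (Finset.image_injective g.injective) _ _
  · intro q hq hmem
    exact hnotUp (hR q) (hUq q hq) (hs.1 hmem).2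
  · intro q hq q' hq' hlt
    rw [← hRs q hq, ← hRs q' hq'] at hlt
    obtain ⟨g, hg, h⟩ := orbit_le_orbit.1 hlt.le
    exact hφ q hq q' hq' (hpiv (hR q) (hR q') hg h).1 fun _ => card_lt_of_orbit_lt hlt
  · intro q hq q' hq' hne hlt
    rw [← hRs q hq] at hlt
    obtain ⟨g, hg, h⟩ := orbit_le_orbit.1 hlt.le
    have hle := hpiv (hR q) (hUc q' hq') hg h
    have htar := (hUq q' hq').target_eq
    obtain ⟨u, hu, hUu, hcard, hpivu⟩ := hUq q' hq'
    rw [hpivu, htar] at hle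
    -- For equal pivot sizes the targets agree too. Since `R q` has no set of target size, its image
    -- in `U q'` avoids the inserted set `u` and lies in `R q'`.
    refine hφ q hq q' hq' hle.1 fun heq => card_lt_of_orbit_lt (lt_of_le_of_ne ?_ ?_)
    · refine orbit_le_orbit.2 ⟨g, hg, fun v hv => ?_⟩
      have hv' := h hv
      rw [hUu] at hv'
      refine (Finset.mem_insert.1 hv').resolve_left fun hvu => ?_
      obtain ⟨w, hw, rfl⟩ := Finset.mem_image.1 hv
      refine (hs.1 hq).2 w (mem_extended_of_mem hw) ?_
      rw [hle.2 heq, ← hcard, ← hvu, Finset.card_image_of_injective _ g.injective]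
    · rwa [hRs q hq, hRs q' hq']
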